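/- A JB*-triple is a complex Banach space $E$ with a continuous triple product $\{\cdot,\cdot,\cdot\}:E\times E\times E\to E$ which is linear and symmetric in the outer variables and conjugate linear in the middle one, such that, with $L(a,b)x:=\{a,b,x\}$: (i) $L(a,b)L(x,y)-L(x,y)L(a,b)=L(L(a,b)x,y)-L(x,L(b,a)y)$ for all $a,b,x,y\in E$; (ii) for every $a\in E$ the operator $L(a,a)$ is hermitian (if $E\neq\{0\}$, $\|e^{itL(a,a)}\|=1$ for all $t\in\mathbb{R}$) with non-negative spectrum; (iii) $\|\{a,a,a\}\|=\|a\|^3$ for every $a\in E$. A tripotent is an element $e\in E$ with $\{e,e,e\}=e$. For $j=0,1,2$ put $E_j(e)=\{x\in E: L(e,e)x=\tfrac{j}{2}x\}$; then $E=E_0(e)\oplus E_1(e)\oplus E_2(e)$, and $P_2(e)$ denotes the corresponding projection of $E$ onto $E_2(e)$, with kernel $E_0(e)\oplus E_1(e)$. The centroid of $E$ is the set of all bounded linear operators $T$ on $E$ with $T\{x,y,z\}=\{T(x),y,z\}$ for all $x,y,z\in E$. Lemma. Let $e$ be a tripotent in a JB*-triple $E$. Then the following statements are equivalent: (a) $E_1(e)=\{0\}$;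 (a') $L(e,e)=P_2(e)$; (b) $L(e,e)$ belongs to the centroid of $E$; (c) there exists $\gamma>0$ such that $\|L(e,x)L(x,e)(e)\|\le\gamma\,\|L(x,e)L(e,x)(e)\|$ for all $x\in E$. -/

import Mathlib

/-- A JB*-triple: a complex Banach space `E` with a continuous triple product
`{a, b, c} = triple a b c`, linear and symmetric in the outer variables and conjugate linear in
the middle one, such that the Jordan identity holds, every operator `L(a, a) = triple a a` is
hermitian with non-negative spectrum, and `‖{a, a, a}‖ = ‖a‖ ^ 3`.
On a Banach space, jointly continuous maps of this type are exactly the elements of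
`E →L[ℂ] E →L⋆[ℂ] E →L[ℂ] E`. -/
class JBStarTriple (E : Type*) [NormedAddCommGroup E] [NormedSpace ℂ E] [CompleteSpace E] where
  /-- The triple product `{a, b, c}`. -/
  triple : E →L[ℂ] E →L⋆[ℂ] E →L[ℂ] E
  /-- Symmetry in the outer variables. -/
  triple_symm : ∀ a b c : E, triple a b c = triple c b a
  /-- The Jordan identity
  `L(a,b) L(x,y) - L(x,y) L(a,b) = L(L(a,b) x, y) - L(x, L(b,a) y)`, where `L(a,b) = triple a b`. -/
  jordan : ∀ a b x y : E,
    (triple a b).comp (triple x y) - (triple x y).comp (triple a b) =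
      triple (triple a b x) y - triple x (triple b a y)
  /-- `L(a, a)` is hermitian, that is `‖exp (i t L(a, a))‖ = 1` for all real `t`.
  (On the zero space the only operator has norm `0`, and the condition is void.) -/
  hermitian : Nontrivial E → ∀ (a : E) (t : ℝ),
    ‖NormedSpace.exp ((Complex.I * (t : ℂ)) • triple a a)‖ = 1
  /-- `L(a, a)` has non-negative spectrum. -/
  spectrum_nonneg : ∀ a : E, ∀ z ∈ spectrum ℂ (triple a a), z.im = 0 ∧ 0 ≤ z.re
  /-- The extended Gelfand–Naimark axiom. -/
  norm_triple_self : ∀ a : E, ‖triple a a a‖ = ‖a‖ ^ 3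

namespace JBStarTriple

/-- The bounded linear operator `L(a, b) : x ↦ {a, b, x}`. -/
noncomputable def L {E : Type*} [NormedAddCommGroup E] [NormedSpace ℂ E] [CompleteSpace E] [JBStarTriple E]
    (a b : E) : E →L[ℂ] E :=
  triple a b

/-- `e` is a tripotent if `{e, e, e} = e`. -/
def IsTripotent {E : Type*} [NormedAddCommGroup E] [NormedSpace ℂ E] [CompleteSpace E]
    [JBStarTriple E] (e : E) : Prop :=
  triple e e e = e

/-- The Peirce subspace `E_j(e)` (`j = 0, 1, 2`): the set of all `x` with `L(e, e) x = (j / 2) x`. -/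
noncomputable def peirceSpace {E : Type*} [NormedAddCommGroup E] [NormedSpace ℂ E] [CompleteSpace E]
    [JBStarTriple E] (e : E) (j : Fin 3) : Submodule ℂ E :=
  Module.End.eigenspace (L e e : E →ₗ[ℂ] E) ((j.val : ℂ) / 2)

/-- The centroid of `E`: all bounded linear `T` with `T {x, y, z} = {T x, y, z}`. -/
def centroid (E : Type*) [NormedAddCommGroup E] [NormedSpace ℂ E] [CompleteSpace E]
    [JBStarTriple E] : Set (E →L[ℂ] E) :=
  {T | ∀ x y z : E, T (triple x y z) = triple (T x) y z}

theorem mem_peirceSpace {E : Type*} [NormedAddCommGroup E] [NormedSpace ℂ E] [CompleteSpace E]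
    [JBStarTriple E] (e x : E) (j : Fin 3) :
    x ∈ peirceSpace e j ↔ L e e x = ((j.val : ℂ) / 2) • x := by
  simp [peirceSpace]

theorem jordan_apply {E : Type*} [NormedAddCommGroup E] [NormedSpace ℂ E] [CompleteSpace E]
    [JBStarTriple E] (a b x y z : E) :
    triple a b (triple x y z) =
      triple (triple a b x) y z - triple x (triple b a y) z + triple x y (triple a b z) := by
  have h := congrArg (fun T : E →L[ℂ] E => T z) (jordan a b x y)
  simp only [sub_apply, ContinuousLinearMap.comp_apply] at h
  rw [← h, sub_add_cancel]

/-- For a tripotent `e`, the operator `L = L(e, e)` satisfies `2 L³ - 3 L² + L = 0`. -/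
theorem IsTripotent.cubic {E : Type*} [NormedAddCommGroup E] [NormedSpace ℂ E] [CompleteSpace E]
    [JBStarTriple E] {e : E} (he : IsTripotent e) (x : E) :
    (2 : ℂ) • L e e (L e e (L e e x)) - (3 : ℂ) • L e e (L e e x) + L e e x = 0 := by
  have he' : triple e e e = e := he
  have h1 : ∀ y : E, triple e y e = (2 : ℂ) • triple e e (triple e y e)
      - triple e (triple e e y) e := fun y => by
    have h := jordan_apply e y e e e
    rw [he', triple_symm y e e, triple_symm (triple e y e) e e] at h
    linear_combination (norm := module) h
  have h2 : ∀ y : E, triple e e (triple e y e) = (2 : ℂ) • triple e y e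
      - triple e (triple e e y) e := fun y => by
    have h := jordan_apply e e e y e
    rw [he'] at h
    linear_combination (norm := module) h
  have h3 : ∀ y : E, triple e e (triple e y e) = triple e y e := fun y => by
    have h : (3 : ℂ) • (triple e e (triple e y e) - triple e y e) = 0 := by
      linear_combination (norm := module) (h2 y) - (h1 y)
    exact sub_eq_zero.mp ((smul_eq_zero.mp h).resolve_left (by norm_num))
  have h4 : triple e (triple e x e) e = (2 : ℂ) • triple e e (triple e e x) - triple e e x := by
    have h := jordan_apply x e e e e
    rw [he', triple_symm x e e, triple_symm (triple e e x) e e] at h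
    linear_combination (norm := module) h
  have h5 := h3 (triple e x e)
  rw [h4, map_sub, map_smul] at h5
  change (2 : ℂ) • triple e e (triple e e (triple e e x)) - (3 : ℂ) • triple e e (triple e e x)
    + triple e e x = 0
  linear_combination (norm := module) h5

/-- The Peirce decomposition, in the form `E = E_2(e) ⊕ (E_0(e) + E_1(e))`. -/
theorem IsTripotent.isCompl {E : Type*} [NormedAddCommGroup E] [NormedSpace ℂ E]
    [CompleteSpace E] [JBStarTriple E] {e : E} (he : IsTripotent e) :
    IsCompl (peirceSpace e 2) (peirceSpace e 0 ⊔ peirceSpace e 1) := by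
  constructor
  · rw [Submodule.disjoint_def]
    intro x hx hx'
    obtain ⟨y, hy, z, hz, rfl⟩ := Submodule.mem_sup.mp hx'
    rw [mem_peirceSpace] at hx hy hz
    simp only [Fin.val_zero, Fin.val_one, Fin.val_two, Nat.cast_zero, Nat.cast_one,
      Nat.cast_ofNat, zero_div, zero_smul] at hx hy hz
    rw [map_add, hy, hz, zero_add] at hx
    have h := congrArg (L e e) hx
    rw [map_smul, map_smul, map_add, hy, hz] at h
    have hz0 : (1 / 4 : ℂ) • z = 0 := by linear_combination (norm := module) -h
    have hz1 : z = 0 := (smul_eq_zero.mp hz0).resolve_left (by norm_num)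
    subst hz1
    linear_combination (norm := module) -hx
  · rw [codisjoint_iff, eq_top_iff]
    intro x _
    have hc := he.cubic x
    have h2 : (2 : ℂ) • L e e (L e e x) - L e e x ∈ peirceSpace e 2 := by
      rw [mem_peirceSpace]
      simp only [Fin.val_two, map_sub, map_smul]
      linear_combination (norm := module) hc
    have h1 : (4 : ℂ) • L e e x - (4 : ℂ) • L e e (L e e x) ∈ peirceSpace e 1 := by
      rw [mem_peirceSpace]
      simp only [Fin.val_one, map_sub, map_smul]
      linear_combination (norm := module) (-2 : ℂ) • hc
    have h0 : x - (3 : ℂ) • L e e x + (2 : ℂ) • L e e (L e e x) ∈ peirceSpace e 0 := by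
      rw [mem_peirceSpace]
      simp only [Fin.val_zero, map_sub, map_add, map_smul]
      linear_combination (norm := module) hc
    refine Submodule.mem_sup.mpr ⟨_, h2, _, Submodule.add_mem_sup h0 h1, ?_⟩
    module

/-- The Peirce projection `P_2(e)`: the linear projection of `E` onto `E_2(e)` with kernel
`E_0(e) ⊕ E_1(e)`. -/
noncomputable def peirceProjTwo {E : Type*} [NormedAddCommGroup E] [NormedSpace ℂ E]
    [CompleteSpace E] [JBStarTriple E] {e : E} (he : IsTripotent e) : E →ₗ[ℂ] E :=
  Submodule.projection (peirceSpace e 2) (peirceSpace e 0 ⊔ peirceSpace e 1) he.isCompl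

end JBStarTriple

/-! Write `L` for `L e e`. Conditions (a), (a') and (b) each say `L² = L`: by the cubic `2L³ - 3L² +
L = 0` the `E_1`-component of `x` is `4(L - L²)x`, and the centroid condition then comes from the
Peirce orthogonality of `E_0` and `E_2`. If `L² = L`, the two vectors in (c) coincide, so `γ = 1`
works.

For (c) ⇒ (a), let `x ∈ E_1(e)`. Then `{e,x,e} = 0`, so (c) forces `{x,x,e} = 0`, and everything
rests on the anisotropy statement `eq_zero_of_triple_eq_zero`. Its core is
`triple_add_triple_eq_zero`. The contractions `exp(-r² L(x+ry, x+ry))` applied to `e` give `‖e -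
r³p‖ ≤ 1 + O(r⁴)` with `p = {x,y,e} + {y,x,e}`. If `p` is self-adjoint in `E_2(e)`, then `n(s) =
‖exp(s L(p,e)) e‖` satisfies `n(3s) = n(s)³`, which turns this flatness at `0` into `n ≤ 1`, on both
half-lines since `y` may be replaced by `-y`. As `exp(it L(p,e))` is contractive, `z ↦ exp(z L(p,e))
e` is bounded and entire, hence constant, and its derivative `p` at `0` vanishes. With `y =
{x,x,x}`, Peirce algebra then yields `x = 0`. -/

/-! ### Exponentials in Banach algebras. -/

section BanachAlgebra

open Filter Topology Asymptotics

variable {A : Type*} [NormedRing A] [NormedAlgebra ℂ A]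

theorem norm_exp_le_of_norm_pow_le {b : A} {C r : ℝ} (h : ∀ k : ℕ, ‖b ^ k‖ ≤ C * r ^ k) :
    ‖NormedSpace.exp b‖ ≤ C * Real.exp r := by
  have hs : HasSum (fun k : ℕ => C * (r ^ k / (k.factorial : ℝ))) (C * Real.exp r) := by
    rw [Real.exp_eq_exp_ℝ]
    exact (NormedSpace.expSeries_div_hasSum_exp r).mul_left C
  rw [NormedSpace.exp_eq_tsum ℂ]
  refine tsum_of_norm_bounded hs fun k => ?_
  rw [norm_smul, norm_inv, Complex.norm_natCast, mul_div_assoc', div_eq_inv_mul]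
  exact mul_le_mul_of_nonneg_left (h k) (by positivity)

/-- The unit need not have norm one, so the constant also has to cover the term `k = 0`. -/
theorem norm_exp_le_mul_exp_norm (b : A) :
    ‖NormedSpace.exp b‖ ≤ (‖(1 : A)‖ + 1) * Real.exp ‖b‖ := by
  refine norm_exp_le_of_norm_pow_le fun k => ?_
  rcases Nat.eq_zero_or_pos k with rfl | hk
  · simp
  · have h1 := norm_pow_le' b hk
    have h2 : 0 ≤ ‖(1 : A)‖ * ‖b‖ ^ k := by positivity
    nlinarith

variable [CompleteSpace A]

/-- Gelfand's spectral radius formula gives the bound for large `k`; the remaining powers are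
absorbed into `C`. -/
theorem exists_norm_pow_le_of_spectrum_le_one {b : A} (hb : ∀ z ∈ spectrum ℂ b, ‖z‖ ≤ 1)
    {r : ℝ} (hr : 1 < r) : ∃ C : ℝ, ∀ k : ℕ, ‖b ^ k‖ ≤ C * r ^ k := by
  have hsr : spectralRadius ℂ b < ENNReal.ofReal r := by
    refine lt_of_le_of_lt (iSup₂_le fun z hz => ?_) (ENNReal.one_lt_ofReal.mpr hr)
    exact_mod_cast hb z hz
  have h0 : 0 < r := by linarith
  have hev := (spectrum.pow_norm_pow_one_div_tendsto_nhds_spectralRadius b).eventually_lt_const hsr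
  have hO : (fun k : ℕ => b ^ k) =O[atTop] fun k : ℕ => r ^ k := by
    refine IsBigO.of_bound 1 ?_
    filter_upwards [hev, eventually_gt_atTop 0] with k hk hk0
    rw [ENNReal.ofReal_lt_ofReal_iff h0] at hk
    have h1 := pow_le_pow_left₀ (by positivity) hk.le k
    rw [one_div, Real.rpow_inv_natCast_pow (norm_nonneg _) hk0.ne'] at h1
    rwa [one_mul, Real.norm_of_nonneg (by positivity)]
  obtain ⟨C, -, hC⟩ := bound_of_isBigO_nat_atTop hO
  refine ⟨C, fun k => ?_⟩
  have := hC (x := k) (by positivity)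
  rwa [Real.norm_of_nonneg (by positivity)] at this

/-- An element with non-negative real spectrum generates a semigroup whose growth is
subexponential. -/
theorem exists_norm_exp_neg_smul_le {T : A}
    (hT : ∀ z ∈ spectrum ℂ T, z.im = 0 ∧ 0 ≤ z.re) {ε : ℝ} (hε : 0 < ε) :
    ∃ C : ℝ, ∀ x : ℝ, 0 ≤ x → ‖NormedSpace.exp (-(x : ℂ) • T)‖ ≤ C * Real.exp (ε * x) := by
  -- `R` bounds the spectrum of `T`, so `b = 1 - T/R` has spectrum in `[0, 1]`, and `exp(-xT) =
  -- e^{-xR} exp(xR b)`.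
  set R : ℝ := ‖T‖ * ‖(1 : A)‖ + 1 with hR
  have hR0 : 0 < R := by positivity
  set b : A := 1 - ((R⁻¹ : ℝ) : ℂ) • T with hb
  have hbs : ∀ z ∈ spectrum ℂ b, ‖z‖ ≤ 1 := by
    intro z hz
    rcases subsingleton_or_nontrivial A with hA | hA
    · simp at hz
    rw [hb, ← map_one (algebraMap ℂ A), ← spectrum.singleton_sub_eq] at hz
    obtain ⟨_, rfl, v, hv, rfl⟩ := Set.mem_sub.mp hz
    have hRc : ((R⁻¹ : ℝ) : ℂ) ≠ 0 := by exact_mod_cast (inv_pos.mpr hR0).ne'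
    rw [← Units.smul_mk0 hRc, spectrum.unit_smul_eq_smul] at hv
    obtain ⟨w, hw, rfl⟩ := hv
    obtain ⟨him, hre⟩ := hT w hw
    have hwn := spectrum.norm_le_norm_mul_of_mem hw
    have hwr : (w.re : ℂ) = w := Complex.ext (by simp) (by simp [him])
    have hle : w.re ≤ R := (Complex.re_le_norm w).trans (by linarith)
    have : (1 : ℂ) - (Units.mk0 _ hRc) • w = ((1 - R⁻¹ * w.re : ℝ) : ℂ) := by
      rw [Units.smul_mk0, ← hwr]
      simp
    change ‖(1 : ℂ) - (Units.mk0 _ hRc) • w‖ ≤ 1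
    rw [this, Complex.norm_real, Real.norm_eq_abs]
    have h1 : R⁻¹ * w.re ≤ 1 := by rw [inv_mul_le_iff₀ hR0]; linarith
    have h2 : 0 ≤ R⁻¹ * w.re := by positivity
    rw [abs_le]; constructor <;> linarith
  obtain ⟨C, hC⟩ := exists_norm_pow_le_of_spectrum_le_one hbs
    (r := 1 + ε / R) (by have := div_pos hε hR0; linarith)
  refine ⟨C, fun x hx => ?_⟩
  let _ := NormedAlgebra.restrictScalars ℚ ℂ A
  have hsplit : -(x : ℂ) • T = algebraMap ℂ A (-((x * R : ℝ) : ℂ)) + ((x * R : ℝ) : ℂ) • b := by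
    rw [hb, Algebra.algebraMap_eq_smul_one, smul_sub, smul_smul, ← Complex.ofReal_mul,
      mul_assoc, mul_inv_cancel₀ hR0.ne', mul_one]
    module
  rw [hsplit, NormedSpace.exp_add_of_commute (Algebra.commutes _ _),
    ← NormedSpace.algebraMap_exp_comm, ← Complex.exp_eq_exp_ℂ, Algebra.algebraMap_eq_smul_one,
    smul_mul_assoc, one_mul, norm_smul, Complex.norm_exp]
  have hb2 : ‖NormedSpace.exp (((x * R : ℝ) : ℂ) • b)‖ ≤
      C * Real.exp (x * R * (1 + ε / R)) := by
    refine norm_exp_le_of_norm_pow_le fun k => ?_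
    rw [smul_pow, norm_smul, norm_pow, Complex.norm_real, Real.norm_of_nonneg (by positivity),
      mul_pow (x * R)]
    have := mul_le_mul_of_nonneg_left (hC k) (show 0 ≤ (x * R) ^ k by positivity)
    linarith
  refine (mul_le_mul_of_nonneg_left hb2 (Real.exp_nonneg _)).trans (le_of_eq ?_)
  rw [mul_left_comm, ← Real.exp_add]
  congr 2
  simp only [Complex.neg_re, Complex.ofReal_re]
  field_simp
  ring

/-- A hermitian element with non-negative spectrum generates a contraction semigroup. -/
theorem norm_exp_neg_smul_le_one {T : A}
    (hherm : ∀ t : ℝ, ‖NormedSpace.exp ((Complex.I * (t : ℂ)) • T)‖ ≤ 1)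
    (hT : ∀ z ∈ spectrum ℂ T, z.im = 0 ∧ 0 ≤ z.re) {s : ℝ} (hs : 0 ≤ s) :
    ‖NormedSpace.exp (-(s : ℂ) • T)‖ ≤ 1 := by
  -- Phragmén–Lindelöf in the right half-plane: the norm is at most `1` on the imaginary axis, and
  -- the factor `e^{-εz}` makes the function bounded on the positive real axis, where only
  -- subexponential growth is known. Then `ε → 0`.
  have key : ∀ ε : ℝ, 0 < ε →
      ‖Complex.exp (-(ε : ℂ) * s) • NormedSpace.exp (-(s : ℂ) • T)‖ ≤ 1 := by
    intro ε hε
    set f : ℂ → A := fun z => Complex.exp (-(ε : ℂ) * z) • NormedSpace.exp (-z • T) with hf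
    have hd : Differentiable ℂ f := by
      refine Differentiable.smul (differentiable_id.const_mul _).cexp ?_
      exact (differentiable_exp_smul_const ℂ T).comp differentiable_neg
    refine PhragmenLindelof.right_half_plane_of_bounded_on_real (f := f) (z := (s : ℂ))
      hd.diffContOnCl ?_ ?_ ?_ (by simpa using hs)
    · refine ⟨1, by norm_num, ε + ‖T‖, IsBigO.of_bound (‖(1 : A)‖ + 1) ?_⟩
      refine Eventually.of_forall fun z => ?_
      rw [hf, norm_smul, Real.rpow_one, Real.norm_of_nonneg (Real.exp_nonneg _), add_mul ε,
        Real.exp_add, mul_left_comm (‖(1 : A)‖ + 1)]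
      refine mul_le_mul ?_ ?_ (norm_nonneg _) (Real.exp_nonneg _)
      · refine (Complex.norm_exp_le_exp_norm _).trans (le_of_eq ?_)
        simp [abs_of_pos hε]
      · refine (norm_exp_le_mul_exp_norm _).trans (le_of_eq ?_)
        rw [norm_smul, norm_neg, mul_comm ‖z‖]
    · obtain ⟨C, hC⟩ := exists_norm_exp_neg_smul_le hT hε
      refine isBoundedUnder_of_eventually_le (a := C) ?_
      filter_upwards [eventually_ge_atTop 0] with x hx
      rw [hf, norm_smul, Complex.norm_exp]
      refine (mul_le_mul_of_nonneg_left (hC x hx) (Real.exp_nonneg _)).trans (le_of_eq ?_)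
      rw [mul_left_comm, ← Real.exp_add]
      simp
    · intro x
      rw [hf, norm_smul, Complex.norm_exp]
      have h1 : -((x : ℂ) * Complex.I) = Complex.I * ((-x : ℝ) : ℂ) := by push_cast; ring
      simpa [h1] using hherm (-x)
  have hlim : Tendsto (fun ε : ℝ =>
      ‖Complex.exp (-(ε : ℂ) * s) • NormedSpace.exp (-(s : ℂ) • T)‖) (𝓝[>] 0)
      (𝓝 ‖NormedSpace.exp (-(s : ℂ) • T)‖) := by
    refine Tendsto.mono_left ?_ nhdsWithin_le_nhds
    exact Continuous.tendsto' (by fun_prop) _ _ (by simp)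
  exact le_of_tendsto hlim (eventually_mem_nhdsWithin.mono fun ε hε => key ε hε)

theorem exists_norm_exp_sub_one_sub_le (A : Type*) [NormedRing A] [NormedAlgebra ℂ A]
    [CompleteSpace A] :
    ∃ C : ℝ, 0 < C ∧ ∀ᶠ T : A in 𝓝 0, ‖NormedSpace.exp T - 1 - T‖ ≤ C * ‖T‖ ^ 2 := by
  have h := (NormedSpace.exp_hasFPowerSeriesAt_zero (𝕂 := ℂ) (𝔸 := A)).isBigO_sub_partialSum_pow 2
  obtain ⟨C, hC0, hC⟩ := h.exists_pos
  refine ⟨C, hC0, hC.bound.mono fun T hT => ?_⟩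
  simpa [FormalMultilinearSeries.partialSum, Finset.sum_range_succ,
    NormedSpace.expSeries_apply_eq, sub_sub] using hT

end BanachAlgebra

/-! ### Differentiating and estimating operators applied to vectors. -/

section Operators

open Filter Topology

variable {E : Type*} [NormedAddCommGroup E] [NormedSpace ℂ E]

theorem isBoundedBilinearMap_apply_restrictScalars :
    IsBoundedBilinearMap ℝ fun p : (E →L[ℂ] E) × E => p.1 p.2 where
  add_left a b c := by simp
  smul_left r a b := by simp
  add_right a b c := by simp
  smul_right r a b := by
    rw [← Complex.coe_smul, map_smul, Complex.coe_smul]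
  bound := ⟨1, one_pos, fun a b => by simpa using a.le_opNorm b⟩

theorem hasDerivAt_clm_apply_of_real {T : ℝ → E →L[ℂ] E} {T' : E →L[ℂ] E} {v : ℝ → E} {v' : E}
    {t : ℝ} (hT : HasDerivAt T T' t) (hv : HasDerivAt v v' t) :
    HasDerivAt (fun t => T t (v t)) (T t v' + T' (v t)) t := by
  have h := (isBoundedBilinearMap_apply_restrictScalars (E := E)).hasFDerivAt (T t, v t)
  exact h.comp_hasDerivAt t (hT.prodMk hv)

/-- The exponential differs from its linear part by `O(r⁶)`, which is within the allowed `O(r⁴)`. -/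
theorem eventually_norm_exp_apply_le [CompleteSpace E] (H : E →L[ℂ] E) {e : E} {C : ℝ}
    (he1 : ‖e‖ ≤ 1)
    (hC : ∀ᶠ r : ℝ in 𝓝[>] 0, ‖e - ((r ^ 3 : ℝ) : ℂ) • H e‖ ≤ 1 + C * r ^ 4) :
    ∃ C' : ℝ, ∀ᶠ r : ℝ in 𝓝[>] 0,
      ‖NormedSpace.exp (((r ^ 3 : ℝ) : ℂ) • -H) e‖ ≤ 1 + C' * r ^ 4 := by
  obtain ⟨K, hK0, hK⟩ := exists_norm_exp_sub_one_sub_le (E →L[ℂ] E)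
  have hlim : Tendsto (fun r : ℝ => ((r ^ 3 : ℝ) : ℂ) • -H) (𝓝[>] 0) (𝓝 0) := by
    refine Tendsto.mono_left ?_ nhdsWithin_le_nhds
    exact Continuous.tendsto' (by fun_prop) _ _ (by simp)
  refine ⟨C + K * ‖H‖ ^ 2, ?_⟩
  filter_upwards [hC, hlim.eventually hK, self_mem_nhdsWithin,
    nhdsWithin_le_nhds (eventually_le_nhds (zero_lt_one' ℝ))] with r hr1 hr2 hr0 hr3
  have hr0' : 0 ≤ r := le_of_lt hr0
  set W := NormedSpace.exp (((r ^ 3 : ℝ) : ℂ) • -H)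
  have hsplit : W e = (e - ((r ^ 3 : ℝ) : ℂ) • H e) + (W - 1 - ((r ^ 3 : ℝ) : ℂ) • -H) e := by
    simp only [sub_apply, smul_apply, neg_apply, one_apply_eq_self]
    module
  have hb : ‖(W - 1 - ((r ^ 3 : ℝ) : ℂ) • -H) e‖ ≤ K * ‖H‖ ^ 2 * r ^ 4 := by
    refine (ContinuousLinearMap.le_opNorm _ e).trans ?_
    refine (mul_le_of_le_one_right (norm_nonneg _) he1).trans (hr2.trans ?_)
    rw [norm_smul, norm_neg, Complex.norm_real, Real.norm_of_nonneg (by positivity), mul_pow]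
    have : (r ^ 3) ^ 2 ≤ r ^ 4 := by
      rw [← pow_mul]; exact pow_le_pow_of_le_one hr0' hr3 (by norm_num)
    calc K * ((r ^ 3) ^ 2 * ‖H‖ ^ 2) ≤ K * (r ^ 4 * ‖H‖ ^ 2) := by gcongr
      _ = _ := by ring
  rw [hsplit]
  refine (norm_add_le _ _).trans ?_
  linarith

end Operators

/-! ### Peirce algebra and the algebraic equivalences. -/

namespace JBStarTriple

section Algebra

variable {E : Type*} [NormedAddCommGroup E] [NormedSpace ℂ E] [CompleteSpace E] [JBStarTriple E]

/-- The commutator `[L(a,b), L(c,y)]` is antisymmetric, so adding the Jordan identity to its version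
with the pairs swapped cancels all compositions. -/
theorem triple_exchange (a b c y d : E) :
    triple (triple a b c) y d + triple (triple c y a) b d =
      triple c (triple b a y) d + triple a (triple y c b) d := by
  linear_combination (norm := module) -(jordan_apply a b c y d) - jordan_apply c y a b d

namespace IsTripotent

variable {e : E}

theorem L_triple_self (he : IsTripotent e) (y : E) :
    triple e e (triple e y e) = triple e y e := by
  have he' : triple e e e = e := he
  have h1 : triple e y e = (2 : ℂ) • triple e e (triple e y e)
      - triple e (triple e e y) e := by
    have h := jordan_apply e y e e e
    rw [he', triple_symm y e e, triple_symm (triple e y e) e e] at h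
    linear_combination (norm := module) h
  have h2 : triple e e (triple e y e) = (2 : ℂ) • triple e y e
      - triple e (triple e e y) e := by
    have h := jordan_apply e e e y e
    rw [he'] at h
    linear_combination (norm := module) h
  have h : (3 : ℂ) • (triple e e (triple e y e) - triple e y e) = 0 := by
    linear_combination (norm := module) h2 - h1
  exact sub_eq_zero.mp ((smul_eq_zero.mp h).resolve_left (by norm_num))

theorem triple_L_self (he : IsTripotent e) (y : E) :
    triple e (triple e e y) e = triple e y e := by
  have h := jordan_apply e e e y e
  rw [show triple e e e = e from he, he.L_triple_self] at h
  linear_combination (norm := module) h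

theorem triple_triple_self (he : IsTripotent e) (x : E) :
    triple e (triple e x e) e = (2 : ℂ) • triple e e (triple e e x) - triple e e x := by
  have h := jordan_apply x e e e e
  rw [show triple e e e = e from he, triple_symm x e e, triple_symm (triple e e x) e e] at h
  linear_combination (norm := module) h

variable {x₀ y₂ : E}

theorem triple_self_zero (he : IsTripotent e) (h0 : triple e e x₀ = 0) :
    triple e x₀ e = 0 := by
  rw [← he.triple_L_self, h0]; simp

theorem triple_left_zero (he : IsTripotent e) (h0 : triple e e x₀ = 0) (d : E) :
    triple e x₀ d = 0 := by
  have h := triple_exchange e e e x₀ d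
  rw [show triple e e e = e from he, he.triple_self_zero h0, h0, triple_symm x₀ e e, h0] at h
  simpa using h

theorem triple_zero_left (he : IsTripotent e) (h0 : triple e e x₀ = 0) (d : E) :
    triple x₀ e d = 0 := by
  have h := triple_exchange x₀ e e e d
  rw [show triple e e e = e from he, he.triple_self_zero h0, h0, triple_symm x₀ e e, h0] at h
  simpa using h.symm

theorem triple_self_triple (he : IsTripotent e) (h2 : triple e e y₂ = y₂) :
    triple e (triple e y₂ e) e = y₂ := by
  rw [he.triple_triple_self, h2, h2]; module

/-- Half of the Peirce orthogonality of `E_2(e)` and `E_0(e)`: write `y₂ = {e, {e,y₂,e}, e}` and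
exchange, so that only products with `L(x₀,e) = 0` remain. -/
theorem triple_two_zero (he : IsTripotent e) (h2 : triple e e y₂ = y₂)
    (h0 : triple e e x₀ = 0) (d : E) : triple y₂ x₀ d = 0 := by
  have h := triple_exchange e (triple e y₂ e) e x₀ d
  rw [he.triple_self_triple h2, he.triple_self_zero h0, triple_symm _ e x₀,
    he.triple_zero_left h0] at h
  simpa using h

theorem triple_zero_two (he : IsTripotent e) (h2 : triple e e y₂ = y₂)
    (h0 : triple e e x₀ = 0) (d : E) : triple x₀ y₂ d = 0 := by
  have h := triple_exchange x₀ e (triple e y₂ e) e d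
  rw [he.triple_self_triple h2, he.triple_self_zero h0, triple_symm _ e x₀,
    he.triple_zero_left h0] at h
  simpa using h.symm

theorem peirceSpace_one_eq_bot_iff (he : IsTripotent e) :
    peirceSpace e 1 = ⊥ ↔ ∀ x : E, triple e e (triple e e x) = triple e e x := by
  constructor
  · intro h x
    have hc := he.cubic x
    have h1 : (4 : ℂ) • L e e x - (4 : ℂ) • L e e (L e e x) ∈ peirceSpace e 1 := by
      rw [mem_peirceSpace]
      simp only [Fin.val_one, map_sub, map_smul]
      linear_combination (norm := module) (-2 : ℂ) • hc
    rw [h, Submodule.mem_bot, ← smul_sub] at h1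
    exact (sub_eq_zero.mp ((smul_eq_zero.mp h1).resolve_left (by norm_num))).symm
  · intro h
    rw [eq_bot_iff]
    intro x hx
    rw [mem_peirceSpace] at hx
    have h' : L e e (L e e x) = L e e x := h x
    rw [hx, map_smul, hx] at h'
    simp only [Fin.val_one, Nat.cast_one] at h'
    have : (1 / 4 : ℂ) • x = 0 := by linear_combination (norm := module) -h'
    exact (smul_eq_zero.mp this).resolve_left (by norm_num)

theorem L_eq_peirceProjTwo_iff (he : IsTripotent e) :
    (L e e : E →ₗ[ℂ] E) = peirceProjTwo he ↔
      ∀ x : E, triple e e (triple e e x) = triple e e x := by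
  constructor
  · intro h x
    have hx : triple e e x ∈ peirceSpace e 2 := by
      have : triple e e x = peirceProjTwo he x := LinearMap.congr_fun h x
      rw [this]
      exact Submodule.projection_apply_mem _ _
    rw [mem_peirceSpace] at hx
    simpa [L] using hx
  · intro h
    ext x
    have h2 : triple e e x ∈ peirceSpace e 2 := by
      rw [mem_peirceSpace]
      simpa [L] using h x
    have h0 : x - triple e e x ∈ peirceSpace e 0 ⊔ peirceSpace e 1 := by
      refine Submodule.mem_sup_left ?_
      rw [mem_peirceSpace]
      simp [L, h x]
    have hx := congrArg (peirceProjTwo he) (add_sub_cancel (triple e e x) x)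
    rw [map_add] at hx
    rw [← hx]
    unfold peirceProjTwo
    rw [Submodule.projection_apply_of_mem_left _ h2, Submodule.projection_apply_of_mem_right _ h0,
      add_zero]
    rfl

theorem L_mem_centroid_iff (he : IsTripotent e) :
    L e e ∈ centroid E ↔ ∀ x : E, triple e e (triple e e x) = triple e e x := by
  constructor
  · intro h x
    have := h e e x
    rwa [show L e e e = e from he] at this
  · intro h x y z
    have h0 : ∀ v, triple e e (v - triple e e v) = 0 := fun v => by rw [map_sub, h, sub_self]
    change triple e e (triple x y z) = triple (triple e e x) y z
    rw [jordan_apply]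
    -- By orthogonality `{x, Ly, z}` and `{x, y, Lz}` both equal `{x, Ly, Lz}`, so they cancel in
    -- the Jordan identity.
    have h1 := he.triple_zero_two (h y) (h0 z) x
    have h2 := he.triple_two_zero (h z) (h0 y) x
    rw [triple_symm, map_sub] at h1
    rw [triple_symm, map_sub, sub_apply] at h2
    linear_combination (norm := module) h2 - h1

/-- The identity `{e, x, {x, e, e}} = {x, e, {e, x, e}}` in the absence of `E_1(e)`. -/
theorem triple_triple_eq_of_idempotent (he : IsTripotent e)
    (h : ∀ x : E, triple e e (triple e e x) = triple e e x) (x : E) :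
    triple e x (triple x e e) = triple x e (triple e x e) := by
  have he' : triple e e e = e := he
  have h0 : triple e e (x - triple e e x) = 0 := by rw [map_sub, h, sub_self]
  set v := triple e e x with hv
  have hv2 : triple e e v = v := h x
  -- The `E_0`-part of `x` is invisible to `L(e,x)` and `L(x,e)`, which reduces the identity to `v ∈
  -- E_2(e)`.
  have hl : ∀ d, triple e x d = triple e v d := fun d => by
    have := he.triple_left_zero h0 d
    rwa [map_sub, sub_apply, sub_eq_zero] at this
  have hr : ∀ d, triple x e d = triple v e d := fun d => by
    have := he.triple_zero_left h0 d
    rwa [map_sub, sub_apply, sub_apply, sub_eq_zero] at this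
  have hve : triple v e e = v := by rw [triple_symm, hv2]
  rw [hl, hl, hr, hr, hve]
  have h1 := jordan_apply v e e v e
  have h2 := jordan_apply v v e e e
  have h3 := jordan_apply e e v v e
  rw [hv2, he', triple_symm v v e] at h3
  rw [he', triple_symm v v e, triple_symm _ e e] at h2
  rw [hve, triple_symm v v e] at h1
  linear_combination (norm := module) h2 - h1 + (2 : ℂ) • h3

end IsTripotent
end Algebra
end JBStarTriple

/-! ### Derivations, contractive semigroups and anisotropy on `E_1(e)`. -/

namespace JBStarTriple

section Derivations

open Filter Topology

variable {E : Type*} [NormedAddCommGroup E] [NormedSpace ℂ E] [CompleteSpace E] [JBStarTriple E]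

theorem isBoundedBilinearMap_triple :
    IsBoundedBilinearMap ℝ fun p : E × E => (triple p.1 p.2 : E →L[ℂ] E) where
  add_left a b c := by simp
  smul_left r a b := by
    rw [← Complex.coe_smul, map_smul, smul_apply, Complex.coe_smul]
  add_right a b c := by simp
  smul_right r a b := by
    rw [← Complex.coe_smul, map_smulₛₗ, Complex.conj_ofReal, Complex.coe_smul]
  bound := by
    obtain ⟨C, hC⟩ : ∃ C : ℝ, ∀ a b : E, ‖(triple a b : E →L[ℂ] E)‖ ≤ C * ‖a‖ * ‖b‖ :=
      ⟨_, fun a b => ContinuousLinearMap.le_opNorm₂ triple a b⟩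
    refine ⟨max C 1, by positivity, fun a b => (hC a b).trans ?_⟩
    gcongr
    exact le_max_left _ _

theorem hasDerivAt_triple {u v w : ℝ → E} {u' v' w' : E} {t : ℝ} (hu : HasDerivAt u u' t)
    (hv : HasDerivAt v v' t) (hw : HasDerivAt w w' t) :
    HasDerivAt (fun t => triple (u t) (v t) (w t))
      (triple (u t) (v t) w' + (triple (u t) v' + triple u' (v t)) (w t)) t := by
  have h := (isBoundedBilinearMap_triple (E := E)).hasFDerivAt (u t, v t)
  have h' := h.comp_hasDerivAt t (hu.prodMk hv)
  exact hasDerivAt_clm_apply_of_real h' hw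

/-- The exponential of a triple derivation (up to a twist in the middle variable) is
multiplicative for the triple product. -/
theorem exp_triple {P R : E →L[ℂ] E}
    (h : ∀ a b c : E, P (triple a b c) = triple (P a) b c + triple a (R b) c + triple a b (P c))
    (a b c : E) :
    NormedSpace.exp P (triple a b c) =
      triple (NormedSpace.exp P a) (NormedSpace.exp R b) (NormedSpace.exp P c) := by
  have hexp : ∀ (K : E →L[ℂ] E) (v : E) (t : ℝ),
      HasDerivAt (fun t : ℝ => NormedSpace.exp (t • K) v) (K (NormedSpace.exp (t • K) v)) t := by
    intro K v t
    simpa using hasDerivAt_clm_apply_of_real (hasDerivAt_exp_smul_const' K t)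
      (hasDerivAt_const t v)
  -- Transporting the product back by `exp(-tP)` gives a curve with zero derivative; compare `t = 1`
  -- with `t = 0`.
  set g : ℝ → E := fun t => NormedSpace.exp (t • (-P))
    (triple (NormedSpace.exp (t • P) a) (NormedSpace.exp (t • R) b)
      (NormedSpace.exp (t • P) c)) with hg
  have hderiv : ∀ t, HasDerivAt g 0 t := by
    intro t
    refine (hasDerivAt_clm_apply_of_real (hasDerivAt_exp_smul_const (-P) t)
      (hasDerivAt_triple (hexp P a t) (hexp R b t) (hexp P c t))).congr_deriv ?_
    simp only [mul_apply_eq_comp, neg_apply, add_apply, h, map_add, map_neg]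
    abel
  have hconst := is_const_of_deriv_eq_zero (f := g) (fun t => (hderiv t).differentiableAt)
    (fun t => (hderiv t).deriv) 1 0
  simp only [hg, one_smul, zero_smul, NormedSpace.exp_zero, one_apply_eq_self]
    at hconst
  rw [← hconst, ← mul_apply_eq_comp]
  let _ := NormedAlgebra.restrictScalars ℚ ℂ (E →L[ℂ] E)
  rw [← NormedSpace.exp_add_of_commute (Commute.refl P).neg_right, add_neg_cancel,
    NormedSpace.exp_zero, one_apply_eq_self]

/-- Bounded triple endomorphisms are contractive. -/
theorem norm_le_one_of_map_triple {T : E →L[ℂ] E}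
    (hT : ∀ a : E, T (triple a a a) = triple (T a) (T a) (T a)) : ‖T‖ ≤ 1 := by
  -- The axiom `‖{a,a,a}‖ = ‖a‖³` gives `‖Ta‖³ ≤ ‖T‖ ‖a‖³`, hence `‖T‖ ≤ ‖T‖^{1/3}`.
  obtain ⟨c, hc0, hc3⟩ : ∃ c : ℝ, 0 ≤ c ∧ c ^ 3 = ‖T‖ :=
    ⟨‖T‖ ^ ((3 : ℕ) : ℝ)⁻¹, by positivity, Real.rpow_inv_natCast_pow (norm_nonneg _) (by norm_num)⟩
  have hle : ‖T‖ ≤ c := by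
    refine T.opNorm_le_bound hc0 fun x => ?_
    refine (pow_le_pow_iff_left₀ (norm_nonneg _) (by positivity) (n := 3) (by norm_num)).mp ?_
    rw [← norm_triple_self, ← hT, mul_pow, hc3, ← norm_triple_self x]
    exact T.le_opNorm _
  by_contra! hlt
  have hc1 : 1 < c := lt_of_lt_of_le hlt hle
  nlinarith [mul_pos (sub_pos.mpr hc1) (show 0 < c * (c + 1) by positivity)]

theorem eq_zero_of_triple_self_eq_zero {v : E} (hv : triple v v v = 0) : v = 0 := by
  have h := norm_triple_self v
  rw [hv, norm_zero] at h
  exact norm_eq_zero.mp ((pow_eq_zero_iff (by norm_num)).mp h.symm)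

/-- The semigroup generated by `-L(a, a)` is contractive. -/
theorem norm_exp_neg_smul_triple_le_one (a : E) {s : ℝ} (hs : 0 ≤ s) :
    ‖NormedSpace.exp (-(s : ℂ) • (triple a a : E →L[ℂ] E))‖ ≤ 1 := by
  refine norm_exp_neg_smul_le_one (fun t => ?_) (spectrum_nonneg a) hs
  rcases subsingleton_or_nontrivial E with hE | hE
  · rw [Subsingleton.elim (NormedSpace.exp ((Complex.I * (t : ℂ)) • (triple a a : E →L[ℂ] E))) 0,
      norm_zero]
    exact zero_le_one
  · exact (hermitian hE a t).le

namespace IsTripotent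

variable {e : E}

theorem norm_le_one (he : IsTripotent e) : ‖e‖ ≤ 1 := by
  have h := norm_triple_self e
  rw [show triple e e e = e from he] at h
  by_contra! hlt
  nlinarith [mul_pos (sub_pos.mpr hlt) (show 0 < ‖e‖ * (‖e‖ + 1) by positivity)]

/-- Since `{x,x,e} = 0`, `L(x+ry, x+ry) e` starts at order `r`. Running the contraction semigroup
for time `r²` puts the linear term at order `r³` and the exponential remainder at order `r⁴`. -/
theorem exists_norm_sub_smul_le (he : IsTripotent e) {x y : E} (hx : triple x x e = 0) :
    ∃ C : ℝ, ∀ᶠ r : ℝ in 𝓝[>] 0,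
      ‖e - ((r ^ 3 : ℝ) : ℂ) • (triple x y e + triple y x e)‖ ≤ 1 + C * r ^ 4 := by
  obtain ⟨C, hC0, hC⟩ := exists_norm_exp_sub_one_sub_le (E →L[ℂ] E)
  set T : ℝ → E →L[ℂ] E := fun r => triple (x + (r : ℂ) • y) (x + (r : ℂ) • y) with hT
  have hTc : Continuous T := by
    have : Continuous fun r : ℝ => x + (r : ℂ) • y := by fun_prop
    exact isBoundedBilinearMap_triple.continuous.comp (this.prodMk this)
  have h1 : ∀ᶠ r : ℝ in 𝓝[>] 0, ‖T r‖ ≤ ‖T 0‖ + 1 := by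
    refine nhdsWithin_le_nhds ?_
    filter_upwards [hTc.norm.continuousAt.eventually_lt_const (lt_add_one ‖T 0‖)] with r hr
      using hr.le
  have h2 : Tendsto (fun r : ℝ => -((r ^ 2 : ℝ) : ℂ) • T r) (𝓝[>] 0) (𝓝 0) := by
    refine Tendsto.mono_left ?_ nhdsWithin_le_nhds
    exact Continuous.tendsto' (by fun_prop) _ _ (by simp)
  refine ⟨‖triple y y e‖ + C * (‖T 0‖ + 1) ^ 2, ?_⟩
  filter_upwards [h1, h2.eventually hC, self_mem_nhdsWithin] with r hr1 hr2 hr0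
  have hr0' : 0 ≤ r := le_of_lt hr0
  have hcontr := norm_exp_neg_smul_triple_le_one (x + (r : ℂ) • y) (sq_nonneg r)
  set W := NormedSpace.exp (-((r ^ 2 : ℝ) : ℂ) • T r) with hW
  have hTe : T r e = (r : ℂ) • (triple x y e + triple y x e) +
      ((r ^ 2 : ℝ) : ℂ) • triple y y e := by
    simp only [hT, map_add, add_apply, map_smulₛₗ, smul_apply, hx, Complex.conj_ofReal,
      RingHom.id_apply]
    push_cast
    module
  have hsplit : e - ((r ^ 3 : ℝ) : ℂ) • (triple x y e + triple y x e) =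
      W e - (W - 1 - -((r ^ 2 : ℝ) : ℂ) • T r) e + ((r ^ 4 : ℝ) : ℂ) • triple y y e := by
    simp only [sub_apply, smul_apply, one_apply_eq_self, hTe]
    push_cast
    module
  have hb1 : ‖W e‖ ≤ 1 := by
    refine (W.le_opNorm e).trans ?_
    exact mul_le_one₀ hcontr (norm_nonneg _) he.norm_le_one
  have hb2 : ‖(W - 1 - -((r ^ 2 : ℝ) : ℂ) • T r) e‖ ≤ C * (‖T 0‖ + 1) ^ 2 * r ^ 4 := by
    refine (ContinuousLinearMap.le_opNorm _ e).trans ?_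
    refine (mul_le_of_le_one_right (norm_nonneg _) he.norm_le_one).trans (hr2.trans ?_)
    rw [norm_smul, norm_neg, Complex.norm_real, Real.norm_of_nonneg (by positivity), mul_pow]
    have : ‖T r‖ ^ 2 ≤ (‖T 0‖ + 1) ^ 2 := by gcongr
    calc C * ((r ^ 2) ^ 2 * ‖T r‖ ^ 2) ≤ C * ((r ^ 2) ^ 2 * (‖T 0‖ + 1) ^ 2) := by gcongr
      _ = _ := by ring
  rw [hsplit]
  refine (norm_add_le _ _).trans ?_
  rw [norm_smul, Complex.norm_real, Real.norm_of_nonneg (by positivity : (0 : ℝ) ≤ r ^ 4)]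
  have := norm_sub_le (W e) ((W - 1 - -((r ^ 2 : ℝ) : ℂ) • T r) e)
  linarith

/-! ### Self-adjoint elements of `E_2(e)`. -/

section SelfAdjoint

variable {p : E}

theorem triple_left_eq_of_selfAdjoint (he : IsTripotent e) (h2 : triple e e p = p)
    (hs : triple e p e = p) : triple e p = triple p e := by
  ext d
  have h := triple_exchange e p e e d
  rw [hs, show triple e e e = e from he, triple_symm p e e, h2] at h
  linear_combination (norm := module) -h

/-- `L(p,e)` is a derivation up to a sign in the middle variable; real multiples keep that sign,
while imaginary ones lose it by conjugate linearity. -/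
theorem triple_apply_triple_of_selfAdjoint (he : IsTripotent e) (h2 : triple e e p = p)
    (hs : triple e p e = p) (a b c : E) :
    triple p e (triple a b c) =
      triple (triple p e a) b c - triple a (triple p e b) c + triple a b (triple p e c) := by
  rw [jordan_apply, he.triple_left_eq_of_selfAdjoint h2 hs]

theorem pow_apply_selfAdjoint (he : IsTripotent e) (h2 : triple e e p = p)
    (hs : triple e p e = p) (n : ℕ) :
    triple e e (((triple p e : E →L[ℂ] E) ^ n) e) = ((triple p e : E →L[ℂ] E) ^ n) e ∧
      triple e (((triple p e : E →L[ℂ] E) ^ n) e) e = ((triple p e : E →L[ℂ] E) ^ n) e := by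
  have he' : triple e e e = e := he
  induction n with
  | zero => simp [he']
  | succ n ih =>
    rw [pow_succ', mul_apply_eq_comp]
    set v := ((triple p e : E →L[ℂ] E) ^ n) e
    obtain ⟨ih2, ihs⟩ := ih
    constructor
    · rw [jordan_apply, h2, he', ih2]
      abel
    · have h := he.triple_apply_triple_of_selfAdjoint h2 hs e v e
      have hpv : triple e v p = triple p e v := by
        rw [he.triple_left_eq_of_selfAdjoint ih2 ihs, triple_symm]
      rw [ihs, triple_symm p e e, h2, triple_symm p v e, hpv] at h
      linear_combination (norm := module) h

theorem exp_apply_selfAdjoint (he : IsTripotent e) (h2 : triple e e p = p)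
    (hs : triple e p e = p) (s : ℝ) :
    triple e (NormedSpace.exp ((s : ℂ) • (triple p e : E →L[ℂ] E)) e) e =
      NormedSpace.exp ((s : ℂ) • (triple p e : E →L[ℂ] E)) e := by
  have hsum := (ContinuousLinearMap.apply ℂ E e).hasSum
    (NormedSpace.exp_series_hasSum_exp' (𝕂 := ℂ) ((s : ℂ) • (triple p e : E →L[ℂ] E)))
  have hQ : Continuous fun v : E => triple e v e :=
    ((triple e).continuous).clm_apply continuous_const
  have hmap := hsum.map (AddMonoidHom.mk' (fun v : E => triple e v e) fun a b => by simp) hQ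
  refine hmap.unique ?_
  refine (congrArg (HasSum · _) (funext fun n => ?_)).mpr hsum
  have hn := (he.pow_apply_selfAdjoint h2 hs n).2
  have hconj : (starRingEnd ℂ) ((n.factorial : ℂ)⁻¹ * (s : ℂ) ^ n) =
      (n.factorial : ℂ)⁻¹ * (s : ℂ) ^ n := by simp
  change triple e (((n.factorial : ℂ)⁻¹ • ((s : ℂ) • (triple p e : E →L[ℂ] E)) ^ n) e) e =
    ((n.factorial : ℂ)⁻¹ • ((s : ℂ) • (triple p e : E →L[ℂ] E)) ^ n) e
  rw [smul_pow, smul_smul, smul_apply, map_smulₛₗ, smul_apply, hn, hconj]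

/-- With `H = L(p,e)` and `u = exp(sH)e`, apply `exp(sH)` to `{e, exp(2sH)e, e} = exp(2sH)e`. The
middle entry is moved by `exp(-sH)`, so the result `exp(3sH)e` equals `{u,u,u}`. -/
theorem norm_exp_three_mul (he : IsTripotent e) (h2 : triple e e p = p)
    (hs : triple e p e = p) (s : ℝ) :
    ‖NormedSpace.exp (((3 * s : ℝ) : ℂ) • (triple p e : E →L[ℂ] E)) e‖ =
      ‖NormedSpace.exp ((s : ℂ) • (triple p e : E →L[ℂ] E)) e‖ ^ 3 := by
  set H : E →L[ℂ] E := triple p e with hH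
  let _ := NormedAlgebra.restrictScalars ℚ ℂ (E →L[ℂ] E)
  have hadd : ∀ u v : ℝ, NormedSpace.exp ((u : ℂ) • H) (NormedSpace.exp ((v : ℂ) • H) e) =
      NormedSpace.exp (((u + v : ℝ) : ℂ) • H) e := by
    intro u v
    rw [Complex.ofReal_add, add_smul, NormedSpace.exp_add_of_commute, mul_apply_eq_comp]
    exact ((Commute.refl H).smul_left _).smul_right _
  have hmul := exp_triple (P := (s : ℂ) • H) (R := ((-s : ℝ) : ℂ) • H) (fun a b c => by
    simp only [smul_apply, map_smul, map_smulₛₗ, Complex.conj_ofReal, hH,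
      he.triple_apply_triple_of_selfAdjoint h2 hs]
    push_cast
    module) e (NormedSpace.exp (((2 * s : ℝ) : ℂ) • H) e) e
  rw [hadd, he.exp_apply_selfAdjoint h2 hs, ← hH, hadd, show s + 2 * s = 3 * s by ring,
    show -s + 2 * s = s by ring] at hmul
  rw [hmul, norm_triple_self]

/-- `it L(p,e)` is a genuine triple derivation, so its exponential preserves the triple product and
is contractive. -/
theorem norm_exp_I_smul_le_one (he : IsTripotent e) (h2 : triple e e p = p)
    (hs : triple e p e = p) (t : ℝ) :
    ‖NormedSpace.exp ((Complex.I * (t : ℂ)) • (triple p e : E →L[ℂ] E))‖ ≤ 1 := by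
  refine norm_le_one_of_map_triple fun a => exp_triple (fun a b c => ?_) a a a
  simp only [smul_apply, map_smul, map_smulₛₗ, map_mul, Complex.conj_ofReal, Complex.conj_I,
    he.triple_apply_triple_of_selfAdjoint h2 hs]
  module

/-- If the norm of `exp(s p)` is sufficiently flat at `s = 0` on one side, then it is bounded
on that side. -/
theorem norm_exp_le_one_of_flat (he : IsTripotent e) (h2 : triple e e p = p)
    (hs : triple e p e = p) {C : ℝ}
    (hC : ∀ᶠ r : ℝ in 𝓝[>] 0,
      ‖NormedSpace.exp (((r ^ 3 : ℝ) : ℂ) • (triple p e : E →L[ℂ] E)) e‖ ≤ 1 + C * r ^ 4)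
    {s : ℝ} (hs0 : 0 ≤ s) :
    ‖NormedSpace.exp ((s : ℂ) • (triple p e : E →L[ℂ] E)) e‖ ≤ 1 := by
  rcases hs0.eq_or_lt with rfl | hs0
  · simpa using he.norm_le_one
  set n : ℝ → ℝ := fun s => ‖NormedSpace.exp ((s : ℂ) • (triple p e : E →L[ℂ] E)) e‖ with hn
  have hpow : ∀ (m : ℕ) (u : ℝ), n (3 ^ m * u) = n u ^ (3 ^ m) := by
    intro m
    induction m with
    | zero => simp
    | succ m ih =>
      intro u
      rw [pow_succ, mul_assoc, ih, pow_succ, pow_mul', ← he.norm_exp_three_mul h2 hs]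
  -- Flatness is used at `r = ρ/3^m`, where `r³ = s/27^m`. Raising to the power `27^m` multiplies
  -- the error `Cρ⁴/81^m` by `27^m`, leaving `Cρ⁴/3^m → 0`.
  obtain ⟨ρ, hρ0, rfl⟩ : ∃ ρ : ℝ, 0 < ρ ∧ ρ ^ 3 = s :=
    ⟨s ^ ((3 : ℕ) : ℝ)⁻¹, by positivity, Real.rpow_inv_natCast_pow hs0.le (by norm_num)⟩
  have hlim3 : Tendsto (fun m : ℕ => ((1 : ℝ) / 3) ^ m) atTop (𝓝 0) :=
    tendsto_pow_atTop_nhds_zero_of_lt_one (by norm_num) (by norm_num)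
  have hlim : Tendsto (fun m : ℕ => ρ * (1 / 3) ^ m) atTop (𝓝[>] 0) := by
    refine tendsto_nhdsWithin_iff.mpr ⟨?_, Eventually.of_forall fun m => ?_⟩
    · simpa using hlim3.const_mul ρ
    · exact Set.mem_Ioi.mpr (by positivity)
  have hev : ∀ᶠ m : ℕ in atTop, n (ρ ^ 3) ≤ Real.exp (C * ρ ^ 4 * (1 / 3) ^ m) := by
    filter_upwards [hlim.eventually hC] with m hm
    have h1 : ρ ^ 3 = 3 ^ (3 * m) * (ρ * (1 / 3) ^ m) ^ 3 := by
      rw [mul_pow, ← pow_mul, mul_comm m 3, mul_left_comm, ← mul_pow]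
      norm_num
    rw [h1, hpow]
    have h3 : n ((ρ * (1 / 3) ^ m) ^ 3) ≤ Real.exp (C * (ρ * (1 / 3) ^ m) ^ 4) := by
      refine le_trans hm ?_
      rw [add_comm]
      exact Real.add_one_le_exp _
    refine (pow_le_pow_left₀ (norm_nonneg _) h3 _).trans (le_of_eq ?_)
    rw [← Real.exp_nat_mul]
    congr 1
    have h4 : (3 : ℝ) ^ (3 * m) * ((1 / 3) ^ m) ^ 4 = (1 / 3) ^ m := by
      rw [show ((1 / 3 : ℝ) ^ m) ^ 4 = (1 / 3) ^ (3 * m) * (1 / 3) ^ m by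
        rw [← pow_mul, ← pow_add]; congr 1; ring, ← mul_assoc, ← mul_pow]
      norm_num
    push_cast
    rw [mul_pow]
    linear_combination C * ρ ^ 4 * h4
  have hlimexp : Tendsto (fun m : ℕ => Real.exp (C * ρ ^ 4 * (1 / 3) ^ m)) atTop (𝓝 1) := by
    have := (Real.continuous_exp.tendsto (C * ρ ^ 4 * 0)).comp (hlim3.const_mul (C * ρ ^ 4))
    rw [mul_zero, Real.exp_zero] at this
    exact this
  exact ge_of_tendsto hlimexp hev

/-- If `{x, x, e} = 0`, then the self-adjoint part of `{x, y, e}` in `E_2(e)` vanishes. -/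
theorem triple_add_triple_eq_zero (he : IsTripotent e) {x y : E} (hx : triple x x e = 0)
    (hp : triple x y e + triple y x e = p) (h2 : triple e e p = p) (hs : triple e p e = p) :
    p = 0 := by
  set H : E →L[ℂ] E := triple p e with hH
  have hHe : H e = p := by rw [hH, triple_symm, h2]
  have hneg : ∀ q : E, (triple (-q) e : E →L[ℂ] E) = -triple q e := fun q => by simp
  have hminus : ∀ s : ℝ, 0 ≤ s → ‖NormedSpace.exp ((s : ℂ) • -H) e‖ ≤ 1 := by
    intro s hs0
    obtain ⟨C, hC⟩ := he.exists_norm_sub_smul_le (y := y) hx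
    rw [hp, ← hHe] at hC
    obtain ⟨C', hC'⟩ := eventually_norm_exp_apply_le H he.norm_le_one hC
    rw [hH, ← hneg] at hC' ⊢
    exact he.norm_exp_le_one_of_flat (by simp [h2]) (by simp [hs]) hC' hs0
  have hplus : ∀ s : ℝ, 0 ≤ s → ‖NormedSpace.exp ((s : ℂ) • H) e‖ ≤ 1 := by
    intro s hs0
    obtain ⟨C, hC⟩ := he.exists_norm_sub_smul_le (y := -y) hx
    have hp' : triple x (-y) e + triple (-y) x e = (-H) e := by
      rw [neg_apply, hHe, ← hp]
      simp only [map_neg, neg_apply]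
      abel
    rw [hp'] at hC
    obtain ⟨C', hC'⟩ := eventually_norm_exp_apply_le (-H) he.norm_le_one hC
    rw [neg_neg] at hC'
    exact he.norm_exp_le_one_of_flat h2 hs hC' hs0
  have hreal : ∀ s : ℝ, ‖NormedSpace.exp ((s : ℂ) • H) e‖ ≤ 1 := by
    intro s
    rcases le_total 0 s with h | h
    · exact hplus s h
    · have := hminus (-s) (by linarith)
      rwa [Complex.ofReal_neg, neg_smul_neg] at this
  -- Liouville: `exp(zH)e` splits into a contraction `exp(i Im z H)` acting on `exp(Re z H)e`, whose
  -- norm is at most `1`.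
  set F : ℂ → E := fun z => NormedSpace.exp (z • H) e with hF
  have hd : Differentiable ℂ F :=
    (differentiable_exp_smul_const ℂ H).clm_apply (differentiable_const e)
  have hbd : Bornology.IsBounded (Set.range F) := by
    refine isBounded_iff_forall_norm_le.mpr ⟨1, ?_⟩
    rintro _ ⟨z, rfl⟩
    let _ := NormedAlgebra.restrictScalars ℚ ℂ (E →L[ℂ] E)
    have hz : z • H = (Complex.I * (z.im : ℂ)) • H + (z.re : ℂ) • H := by
      rw [← add_smul]
      congr 1
      rw [mul_comm, add_comm, Complex.re_add_im]
    rw [hF]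
    change ‖NormedSpace.exp (z • H) e‖ ≤ 1
    rw [hz, NormedSpace.exp_add_of_commute (((Commute.refl H).smul_left _).smul_right _),
      mul_apply_eq_comp]
    refine (ContinuousLinearMap.le_opNorm _ _).trans ?_
    exact mul_le_one₀ (he.norm_exp_I_smul_le_one h2 hs _) (norm_nonneg _) (hreal _)
  have hconst : F = fun _ => F 0 := funext fun z => hd.apply_eq_apply_of_bounded hbd z 0
  have hder : HasDerivAt F (H e) 0 := by
    have := (hasDerivAt_exp_smul_const (𝕂 := ℂ) H 0).clm_apply (hasDerivAt_const (0 : ℂ) e)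
    simpa using this
  rw [hconst] at hder
  rw [← hHe]
  exact hder.unique (hasDerivAt_const _ _)

end SelfAdjoint

set_option maxHeartbeats 1000000 in
/-- The quadratic map `x ↦ {x, x, e}` is anisotropic on `E_1(e)`. -/
theorem eq_zero_of_triple_eq_zero (he : IsTripotent e) {x : E}
    (hx1 : triple e e x = (1 / 2 : ℂ) • x) (hx : triple x x e = 0) : x = 0 := by
  have he' : triple e e e = e := he
  have hxee : triple x e e = (1 / 2 : ℂ) • x := by rw [triple_symm, hx1]
  have hexx : triple e x x = 0 := by rw [triple_symm, hx]
  set c := triple x x x with hc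
  have hc1 : triple e e c = (1 / 2 : ℂ) • c := by
    rw [hc, jordan_apply, hx1]
    simp only [map_smulₛₗ, smul_apply, map_div₀, map_one, RingHom.id_apply, Complex.conj_ofNat]
    module
  have hcx : triple c x = triple x c := by
    ext d
    have h := triple_exchange x x x x d
    linear_combination (norm := module) (1 / 2 : ℂ) • h
  set w := triple x e x with hw
  -- the element `{x, c, e}` is self-adjoint in `E_2(e)`
  have hp : triple x c e = 0 := by
    have h2 : triple e e (triple x c e) = triple x c e := by
      rw [jordan_apply, hx1, hc1, he']
      simp only [map_smulₛₗ, smul_apply, map_div₀, map_one, RingHom.id_apply, Complex.conj_ofNat]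
      module
    have hs : triple e (triple x c e) e = triple x c e := by
      have h := jordan_apply c x e e e
      rw [he', hcx, triple_symm _ e e, h2] at h
      linear_combination (norm := module) h
    have := he.triple_add_triple_eq_zero (p := (2 : ℂ) • triple x c e) hx (y := c)
      (by rw [hcx]; module) (by rw [map_smul, h2])
      (by simp only [map_smulₛₗ, smul_apply, hs, Complex.conj_ofNat])
    exact (smul_eq_zero.mp this).resolve_left (by norm_num)
  have hecx : triple e x c = 0 := by rw [triple_symm, hcx, hp]
  have hw0 : triple e e w = 0 := by
    rw [hw, jordan_apply, hx1, he']
    simp only [map_smulₛₗ, smul_apply, RingHom.id_apply]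
    module
  have hxwx : triple x w x = 0 := by
    have h := jordan_apply e x x x x
    rw [← hc, hecx, hexx, ← hw] at h
    simpa using h
  have hexw : triple e x w = -(1 / 2 : ℂ) • c := by
    have h := jordan_apply e x x e x
    rw [hexx, hxee] at h
    simp only [map_smulₛₗ, smul_apply, map_div₀, map_one, Complex.conj_ofNat] at h
    rw [← hw, ← hc] at h
    simpa using h
  -- As operators `L(w,w) = -L(x,c)`; this makes `L(w,w)` annihilate `x` as soon as `{x,c,x} = 0`.
  have hww : ∀ d, triple w w d = -triple x c d := by
    intro d
    have h := triple_exchange x w x e d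
    rw [← hw, hxwx, triple_symm w x e, hexw] at h
    simp only [map_smulₛₗ, smul_apply, map_neg, map_div₀, map_one, Complex.conj_ofNat,
      map_zero, zero_apply] at h
    linear_combination (norm := module) h
  have hxcx : triple x c x = 0 := by
    have h := jordan_apply x w x e x
    rw [hxwx, triple_symm w x e, hexw, ← hw, triple_symm x w w, hww] at h
    simp only [map_smulₛₗ, smul_apply, map_neg, map_div₀, map_one, Complex.conj_ofNat,
      map_zero, zero_apply] at h
    have h3 : (3 / 2 : ℂ) • triple x c x = 0 := by
      linear_combination (norm := module) -h
    exact (smul_eq_zero.mp h3).resolve_left (by norm_num)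
  have hwwx : triple w w x = 0 := by rw [hww, hxcx, neg_zero]
  have hwwe : triple w w e = 0 := by rw [triple_symm, he.triple_left_zero hw0]
  -- Expanding `L(w,w){x,e,x}` by the Jordan identity leaves only terms containing `{w,w,x}` or
  -- `{w,w,e}`. Then `w = 0`, and `{e,x,w} = -c/2` gives `c = 0`.
  have hwww : triple w w w = 0 := by
    have h := jordan_apply w w x e x
    rw [← hw, hwwx, hwwe] at h
    rw [h]
    simp only [map_zero, zero_apply, sub_self, add_zero]
  rw [eq_zero_of_triple_self_eq_zero hwww, map_zero] at hexw
  refine eq_zero_of_triple_self_eq_zero ((smul_eq_zero.mp hexw.symm).resolve_left (by norm_num))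

end IsTripotent
end Derivations
end JBStarTriple

/-! ### The equivalence theorem. -/

theorem lemmal {E : Type*} [NormedAddCommGroup E] [NormedSpace ℂ E] [CompleteSpace E]
    [JBStarTriple E] (e : E) (he : JBStarTriple.IsTripotent e) :
    List.TFAE
      [JBStarTriple.peirceSpace e 1 = ⊥,
        (JBStarTriple.L e e : E →ₗ[ℂ] E) = JBStarTriple.peirceProjTwo he,
        JBStarTriple.L e e ∈ JBStarTriple.centroid E,
        ∃ γ : ℝ, 0 < γ ∧ ∀ x : E,
          ‖JBStarTriple.L e x (JBStarTriple.L x e e)‖ ≤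
            γ * ‖JBStarTriple.L x e (JBStarTriple.L e x e)‖] := by
  tfae_have 1 ↔ 2 := he.peirceSpace_one_eq_bot_iff.trans he.L_eq_peirceProjTwo_iff.symm
  tfae_have 1 ↔ 3 := he.peirceSpace_one_eq_bot_iff.trans he.L_mem_centroid_iff.symm
  tfae_have 1 → 4 := fun h => ⟨1, one_pos, fun x => by
    rw [one_mul]
    exact (congrArg norm (he.triple_triple_eq_of_idempotent
      (he.peirceSpace_one_eq_bot_iff.mp h) x)).le⟩
  tfae_have 4 → 1 := by
    rintro ⟨γ, -, hγ⟩
    rw [eq_bot_iff]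
    intro x hx
    rw [JBStarTriple.mem_peirceSpace] at hx
    have hx1 : JBStarTriple.triple e e x = (1 / 2 : ℂ) • x := by
      simpa [JBStarTriple.L] using hx
    -- `{e, Lx, e} = {e,x,e}` while `Lx = x/2`, so the right side of (c) vanishes on `E_1(e)`; the
    -- left side is the norm of `{e,x,x}/2`.
    have hexe : JBStarTriple.triple e x e = 0 := by
      have h := he.triple_L_self x
      rw [hx1] at h
      simp only [map_smulₛₗ, smul_apply, map_div₀, map_one, Complex.conj_ofNat] at h
      have h2 : (1 / 2 : ℂ) • JBStarTriple.triple e x e = 0 := by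
        linear_combination (norm := module) -h
      exact (smul_eq_zero.mp h2).resolve_left (by norm_num)
    have h := hγ x
    simp only [JBStarTriple.L, hexe, map_zero, norm_zero, mul_zero,
      JBStarTriple.triple_symm x e e, hx1, map_smul] at h
    have h0 := (smul_eq_zero.mp (norm_le_zero_iff.mp h)).resolve_left (by norm_num)
    rw [JBStarTriple.triple_symm] at h0
    exact (Submodule.mem_bot ℂ).mpr (he.eq_zero_of_triple_eq_zero hx1 h0)
  tfae_finish
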